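/- Let $X=\mathbb R^n$ (real case) or $X=\mathbb C^n$ (complex case) with its canonical inner product, and let $(e_1,\dots,e_n)$ be any orthonormal basis of $X$. For $I=\{i_1<\dots<i_p\}\subset\{1,\dots,n\}$ let $[e_I]=\operatorname{span}(e_{i_1},\dots,e_{i_p})$ be the corresponding $p$-dimensional coordinate subspace (real span in the real case, complex span in the complex case). Let $V\subset X$ be a $p$-dimensional subspace (over $\mathbb R$, resp. over $\mathbb C$), and let $k=p$ in the real case and $k=2p$ in the complex case. Let $S\subset V$ be a Lebesgue measurable subset of $V$, let $\mathcal V\in[0,\infty]$ be its $k$-dimensional volume, i.e. its $k$-dimensional Hausdorff measure normalized so as to agree with Lebesgue measure on $\mathbb R^k$, where $\mathbb C^n$ is regarded as $\mathbb R^{2n}$. For each $I$ with $p$ elements, let $\mathcal V_I\in[0,\infty]$ be the $k$-dimensional volume of the orthogonal projection of $S$ on $[e_I]$. Then these projections are measurable, so that the $\mathcal V_I$ are well defined, and $$\mathcal V^2=\sum_I \mathcal V_I^2\ \text{ in the real case},\qquad \mathcal V=\sum_I\mathcal V_I\ \text{ in the complex case},$$ where $I$ ranges over all $p$-element subsets of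 $\{1,\dots,n\}$. -/

import Mathlib

open MeasureTheory
open scoped MeasureTheory ENNReal

/-- The coordinate subspace `[e_I]`, spanned over `𝕜` by the basis vectors `e_i` with `i ∈ I`.
Strictly increasing multi-indices `(i₁, …, i_p)` are represented by their sets of entries. -/
def coordSubspace {𝕜 : Type*} [RCLike 𝕜] {n : ℕ}
    (e : OrthonormalBasis (Fin n) 𝕜 (EuclideanSpace 𝕜 (Fin n))) (I : Finset (Fin n)) :
    Submodule 𝕜 (EuclideanSpace 𝕜 (Fin n)) :=
  Submodule.span 𝕜 (e '' (I : Set (Fin n)))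

/-- The orthogonal projection of the set `S` on the coordinate subspace `[e_I]`,
as a subset of the whole space. -/
noncomputable def coordProj {𝕜 : Type*} [RCLike 𝕜] {n : ℕ}
    (e : OrthonormalBasis (Fin n) 𝕜 (EuclideanSpace 𝕜 (Fin n))) (I : Finset (Fin n))
    (S : Set (EuclideanSpace 𝕜 (Fin n))) : Set (EuclideanSpace 𝕜 (Fin n)) :=
  (coordSubspace e I).starProjection '' S

/-! On `V` the projection to `[e_I]` is linear, so it scales volume by a constant: `c_I = normDet`
in the real case, and `c_I ^ 2` in the complex case, since the real determinant of a complex linear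
map is the squared modulus of the complex one. Both identities thus reduce to `∑ c_I ^ 2 = 1`. If
`A` holds the `e`-coordinates of an orthonormal basis of `V`, then `c_I ^ 2` is the squared modulus
of the minor of `A` with rows `I`, and by Cauchy–Binet these sum to `det (Aᴴ * A) = 1`. -/

open Polynomial in
/-- The squared absolute values of the maximal minors of a matrix with orthonormal columns
sum to one. -/
theorem Matrix.sum_powersetCard_det_submatrix_mul_conjTranspose_eq_one
    {R ι κ : Type*} [CommRing R] [StarRing R] [Fintype ι] [DecidableEq ι] [Fintype κ]
    [DecidableEq κ] (A : Matrix ι κ R) (hA : A.conjTranspose * A = 1) :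
    ∑ I ∈ (Finset.univ : Finset ι).powersetCard (Fintype.card κ),
      ((A * A.conjTranspose).submatrix (Subtype.val : I → ι) (Subtype.val : I → ι)).det = 1 := by
  -- With `p = card κ`, compare the coefficients of `X ^ p` in `det (1 + X A Aᴴ) = det (1 + X Aᴴ A)
  -- = (1 + X) ^ p`.
  rw [← Matrix.coeff_det_one_add_X_smul_eq_sum_minors, Matrix.map_mul, ← Matrix.smul_mul,
    Matrix.det_one_add_mul_comm, Matrix.mul_smul, ← Matrix.map_mul, hA,
    Matrix.map_one _ (map_zero C) (map_one C),
    show (1 + (X : R[X]) • (1 : Matrix κ κ R[X])) = (1 + X : R[X]) • (1 : Matrix κ κ R[X]) by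
      rw [add_smul, one_smul], Matrix.det_smul, Matrix.det_one, mul_one, coeff_one_add_X_pow]
  simp

section Projection

variable {𝕜 : Type*} [RCLike 𝕜] {n : ℕ}

/-- The projection on `[e_I]` keeps the coordinates in `I` and kills the others. -/
theorem repr_starProjection_coordSubspace
    (e : OrthonormalBasis (Fin n) 𝕜 (EuclideanSpace 𝕜 (Fin n))) (I : Finset (Fin n))
    (x : EuclideanSpace 𝕜 (Fin n)) (i : Fin n) :
    e.repr ((coordSubspace e I).starProjection x) i = if i ∈ I then e.repr x i else 0 := by
  rw [e.repr_apply_apply, e.repr_apply_apply, ← Submodule.inner_starProjection_left_eq_right]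
  split_ifs with h
  · rw [(Submodule.starProjection_eq_self_iff (K := coordSubspace e I)).2
      (Submodule.subset_span (Set.mem_image_of_mem e (Finset.mem_coe.2 h)))]
  · have : e i ∈ (coordSubspace e I)ᗮ := by
      rw [coordSubspace, Submodule.mem_orthogonal]
      intro u hu
      induction hu using Submodule.span_induction with
      | mem u hu =>
        obtain ⟨j, hj, rfl⟩ := hu
        exact e.orthonormal.2 fun hji => h (hji ▸ hj)
      | zero => simp
      | add u v _ _ hu hv => rw [inner_add_left, hu, hv, add_zero]
      | smul c u _ hu => rw [inner_smul_left, hu, mul_zero]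
    rw [(Submodule.starProjection_apply_eq_zero_iff _).2 this, inner_zero_left]

/-- The orthogonal projection on `[e_I]`, restricted to the subspace `V`. -/
noncomputable def coordProjMap (e : OrthonormalBasis (Fin n) 𝕜 (EuclideanSpace 𝕜 (Fin n)))
    (I : Finset (Fin n)) (V : Submodule 𝕜 (EuclideanSpace 𝕜 (Fin n))) :
    V →ₗ[𝕜] EuclideanSpace 𝕜 (Fin n) :=
  (coordSubspace e I).starProjection.toLinearMap ∘ₗ V.subtype

theorem coordProjMap_apply (e : OrthonormalBasis (Fin n) 𝕜 (EuclideanSpace 𝕜 (Fin n)))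
    (I : Finset (Fin n)) (V : Submodule 𝕜 (EuclideanSpace 𝕜 (Fin n))) (x : V) :
    coordProjMap e I V x = (coordSubspace e I).starProjection x :=
  rfl

/-- The squared volume factors of the projections of a `p`-dimensional subspace on the
`p`-dimensional coordinate subspaces sum to one. -/
theorem sum_normDet_starProjection_coordSubspace_sq
    (e : OrthonormalBasis (Fin n) 𝕜 (EuclideanSpace 𝕜 (Fin n)))
    (V : Submodule 𝕜 (EuclideanSpace 𝕜 (Fin n))) :
    ∑ I ∈ (Finset.univ : Finset (Fin n)).powersetCard (Module.finrank 𝕜 V),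
      LinearMap.normDet (𝕜 := 𝕜) (U := V) (V := EuclideanSpace 𝕜 (Fin n))
        (coordProjMap e I V) ^ 2 = 1 := by
  let b := stdOrthonormalBasis 𝕜 V
  let A : Matrix (Fin n) (Fin (Module.finrank 𝕜 V)) 𝕜 :=
    Matrix.of fun i j => e.repr (b j : EuclideanSpace 𝕜 (Fin n)) i
  have hA : A.conjTranspose * A = 1 := by
    rw [← Matrix.gram_eq_conjTranspose_mul e fun j => (b j : EuclideanSpace 𝕜 (Fin n)),
      Matrix.gram_eq_one_iff_orthonormal]
    exact b.orthonormal.comp_linearIsometry V.subtypeₗᵢ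
  have key := Matrix.sum_powersetCard_det_submatrix_mul_conjTranspose_eq_one A hA
  rw [Fintype.card_fin] at key
  rw [← RCLike.ofReal_inj (K := 𝕜), RCLike.ofReal_one, ← key, RCLike.ofReal_sum]
  refine Finset.sum_congr rfl fun I hI => ?_
  -- Indexing the rows in `I` by `σ` makes `B` square, so `det (B * Bᴴ) = det (Bᴴ * B)`, and `Bᴴ *
  -- B` is the Gram matrix of the projected basis.
  have σ : Fin (Module.finrank 𝕜 V) ≃ I :=
    (Fintype.equivFinOfCardEq (by simpa using (Finset.mem_powersetCard.1 hI).2)).symm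
  let B := A.submatrix (fun k => (σ k : Fin n)) id
  have hB : B * B.conjTranspose = ((A * A.conjTranspose).submatrix
      (Subtype.val : I → Fin n) (Subtype.val : I → Fin n)).submatrix σ σ := by
    ext i j
    simp [B, Matrix.mul_apply]
  rw [LinearMap.normDet_sq_eq_det_gram _ b, ← Matrix.det_submatrix_equiv_self σ, ← hB,
    Matrix.det_mul_comm, Matrix.gram_eq_conjTranspose_mul e]
  congr 1
  ext i j
  simp only [Matrix.mul_apply, Matrix.conjTranspose_apply, Matrix.of_apply, coordProjMap_apply,
    repr_starProjection_coordSubspace]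
  simp only [apply_ite star, star_zero, mul_ite, ite_mul, zero_mul, mul_zero, ← ite_and, and_self,
    B, A, Matrix.submatrix_apply, id_eq, Matrix.of_apply]
  rw [Finset.sum_ite_mem, Finset.univ_inter, ← Finset.sum_coe_sort I, ← σ.sum_comp]

end Projection

section Measure

/-- A linear image of a null measurable set is null measurable for the Euclidean Hausdorff measure
of the dimension of the source. -/
theorem LinearMap.nullMeasurableSet_image_euclideanHausdorffMeasure {U F : Type*}
    [NormedAddCommGroup U] [InnerProductSpace ℝ U] [FiniteDimensional ℝ U] [MeasurableSpace U]
    [BorelSpace U] [NormedAddCommGroup F] [InnerProductSpace ℝ F] [MeasurableSpace F]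
    [BorelSpace F] (f : U →ₗ[ℝ] F) {T : Set U}
    (hT : NullMeasurableSet T μHE[Module.finrank ℝ U]) :
    NullMeasurableSet (f '' T) μHE[Module.finrank ℝ U] := by
  -- A non-injective map has null image, even when `T` has infinite measure. An injective one is a
  -- closed embedding: it keeps a Borel core Borel and the null remainder null.
  by_cases hf : f.normDet = 0
  · exact NullMeasurableSet.of_null (by simp [f.euclideanHausdorffMeasure_image, hf])
  · have hker : f.ker = ⊥ := (f.normDet_ne_zero_tfae.out 0 1).1 hf
    obtain ⟨t, htT, ht, hae⟩ := hT.exists_measurable_subset_ae_eq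
    have hnull : μHE[Module.finrank ℝ U] (T \ t) = 0 := (ae_eq_set.1 hae).2
    rw [← Set.union_sdiff_cancel htT, Set.image_union]
    exact ((LinearMap.isClosedEmbedding_of_injective hker).measurableEmbedding.measurableSet_image.2
      ht).nullMeasurableSet.union
        (NullMeasurableSet.of_null (by rw [f.euclideanHausdorffMeasure_image, hnull, mul_zero]))

/-- Null measurability of a set contained in the range of an isometry can be checked upstairs. -/
theorem Isometry.nullMeasurableSet_preimage_euclideanHausdorffMeasure {X Y : Type*}
    [EMetricSpace X] [MeasurableSpace X] [BorelSpace X] [EMetricSpace Y] [MeasurableSpace Y]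
    [BorelSpace Y] {f : X → Y} (hf : Isometry f) {d : ℕ} {S : Set Y}
    (hS : NullMeasurableSet S μHE[d]) : NullMeasurableSet (f ⁻¹' S) μHE[d] :=
  -- The pushforward under `f` is the restriction to its range, so null sets pull back to null sets.
  hS.preimage ⟨hf.continuous.measurable, by
    rw [hf.map_euclideanHausdorffMeasure]
    exact Measure.absolutelyContinuous_of_le Measure.restrict_le_self⟩

end Measure

section Complex

variable {U F : Type*} [NormedAddCommGroup U] [InnerProductSpace ℂ U] [FiniteDimensional ℂ U]
  [NormedAddCommGroup F] [InnerProductSpace ℂ F]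

/-- The real volume factor of a complex linear map is the square of its complex one. -/
theorem LinearMap.normDet_restrictScalars_real [FiniteDimensional ℂ F] (f : U →ₗ[ℂ] F) :
    letI : InnerProductSpace ℝ U := InnerProductSpace.complexToReal
    letI : InnerProductSpace ℝ F := InnerProductSpace.complexToReal
    haveI : FiniteDimensional ℝ U := FiniteDimensional.complexToReal U
    (f.restrictScalars ℝ).normDet = f.normDet ^ 2 := by
  let : InnerProductSpace ℝ U := InnerProductSpace.complexToReal
  let : InnerProductSpace ℝ F := InnerProductSpace.complexToReal
  have : FiniteDimensional ℝ U := FiniteDimensional.complexToReal U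
  have : FiniteDimensional ℝ F := FiniteDimensional.complexToReal F
  -- The real inner product is the real part of the complex one.
  have hadj : (f.restrictScalars ℝ).adjoint = f.adjoint.restrictScalars ℝ := by
    symm
    rw [LinearMap.eq_adjoint_iff]
    intro x y
    exact congrArg Complex.re (LinearMap.adjoint_inner_left f y x)
  have h : (f.restrictScalars ℝ).normDet ^ 2 = (f.normDet ^ 2) ^ 2 := by
    -- The real determinant of `f* f` is the norm from `ℂ` to `ℝ` of its complex determinant, which
    -- is real; the norm of a real `r` is `r ^ 2`.
    have h1 := (f.restrictScalars ℝ).normDet_sq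
    rw [hadj, ← LinearMap.restrictScalars_comp, LinearMap.det_restrictScalars,
      ← f.normDet_sq] at h1
    have h2 := Algebra.norm_algebraMap (S := ℂ) (f.normDet ^ 2)
    rw [Complex.finrank_real_complex] at h2
    exact h1.trans h2
  exact (sq_eq_sq₀ (LinearMap.normDet_nonneg _) (sq_nonneg _)).1 h

variable [MeasurableSpace U] [BorelSpace U] [MeasurableSpace F] [BorelSpace F]

theorem LinearMap.euclideanHausdorffMeasure_image_complex [FiniteDimensional ℂ F] (f : U →ₗ[ℂ] F)
    (s : Set U) :
    μHE[2 * Module.finrank ℂ U] (f '' s) =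
      ENNReal.ofReal (f.normDet ^ 2) * μHE[2 * Module.finrank ℂ U] s := by
  let : InnerProductSpace ℝ U := InnerProductSpace.complexToReal
  let : InnerProductSpace ℝ F := InnerProductSpace.complexToReal
  have : FiniteDimensional ℝ U := FiniteDimensional.complexToReal U
  rw [← f.normDet_restrictScalars_real, ← finrank_real_of_complex]
  exact (f.restrictScalars ℝ).euclideanHausdorffMeasure_image s

theorem LinearMap.nullMeasurableSet_image_euclideanHausdorffMeasure_complex (f : U →ₗ[ℂ] F)
    {T : Set U} (hT : NullMeasurableSet T μHE[2 * Module.finrank ℂ U]) :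
    NullMeasurableSet (f '' T) μHE[2 * Module.finrank ℂ U] := by
  let : InnerProductSpace ℝ U := InnerProductSpace.complexToReal
  let : InnerProductSpace ℝ F := InnerProductSpace.complexToReal
  have : FiniteDimensional ℝ U := FiniteDimensional.complexToReal U
  rw [← finrank_real_of_complex] at hT ⊢
  exact (f.restrictScalars ℝ).nullMeasurableSet_image_euclideanHausdorffMeasure hT

end Complex

/-- Passing to a map with source `V` matches the source dimension with that of the measure, as the
scaling formula requires. -/
theorem coordProj_eq_image_preimage {𝕜 : Type*} [RCLike 𝕜] {n : ℕ}
    (e : OrthonormalBasis (Fin n) 𝕜 (EuclideanSpace 𝕜 (Fin n))) (I : Finset (Fin n))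
    {V : Submodule 𝕜 (EuclideanSpace 𝕜 (Fin n))} {S : Set (EuclideanSpace 𝕜 (Fin n))}
    (hS : S ⊆ V) :
    coordProj e I S = coordProjMap e I V ''
      ((Subtype.val : V → EuclideanSpace 𝕜 (Fin n)) ⁻¹' S) := by
  have : Subtype.val '' ((Subtype.val : V → EuclideanSpace 𝕜 (Fin n)) ⁻¹' S) = S :=
    Subtype.image_preimage_coe _ _ |>.trans (Set.inter_eq_self_of_subset_right hS)
  conv_lhs => rw [coordProj, ← this, Set.image_image]
  rfl

theorem euclideanHausdorffMeasure_val_preimage {𝕜 E : Type*} [RCLike 𝕜] [NormedAddCommGroup E]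
    [InnerProductSpace 𝕜 E] [MeasurableSpace E] [BorelSpace E] {V : Submodule 𝕜 E} {S : Set E}
    (hS : S ⊆ V) (d : ℕ) : μHE[d] ((Subtype.val : V → E) ⁻¹' S) = μHE[d] S := by
  rw [isometry_subtype_coe.euclideanHausdorffMeasure_preimage, Subtype.range_coe,
    Set.inter_eq_self_of_subset_left hS]

section ComplexSubmodule

variable {E F : Type*} [NormedAddCommGroup E] [InnerProductSpace ℂ E] [MeasurableSpace E]
  [BorelSpace E] [NormedAddCommGroup F] [InnerProductSpace ℂ F] [MeasurableSpace F] [BorelSpace F]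

theorem Submodule.nullMeasurableSet_image_preimage_complex (V : Submodule ℂ E)
    [FiniteDimensional ℂ V] (f : V →ₗ[ℂ] F) {S : Set E}
    (hS : NullMeasurableSet S μHE[2 * Module.finrank ℂ V]) :
    NullMeasurableSet (f '' ((Subtype.val : V → E) ⁻¹' S)) μHE[2 * Module.finrank ℂ V] :=
  f.nullMeasurableSet_image_euclideanHausdorffMeasure_complex
    (isometry_subtype_coe.nullMeasurableSet_preimage_euclideanHausdorffMeasure hS)

theorem Submodule.euclideanHausdorffMeasure_image_preimage_complex [FiniteDimensional ℂ F]
    (V : Submodule ℂ E) [FiniteDimensional ℂ V] (f : V →ₗ[ℂ] F) {S : Set E} (hS : S ⊆ V) :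
    μHE[2 * Module.finrank ℂ V] (f '' ((Subtype.val : V → E) ⁻¹' S)) =
      ENNReal.ofReal (f.normDet ^ 2) * μHE[2 * Module.finrank ℂ V] S := by
  rw [f.euclideanHausdorffMeasure_image_complex, euclideanHausdorffMeasure_val_preimage hS]

end ComplexSubmodule

theorem mainTheorem6 (n p : ℕ) :
    (∀ (e : OrthonormalBasis (Fin n) ℝ (EuclideanSpace ℝ (Fin n)))
        (V : Submodule ℝ (EuclideanSpace ℝ (Fin n))) (S : Set (EuclideanSpace ℝ (Fin n))),
      Module.finrank ℝ V = p → S ⊆ V → NullMeasurableSet S μHE[p] →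
        (∀ I ∈ (Finset.univ : Finset (Fin n)).powersetCard p,
          NullMeasurableSet (coordProj e I S) μHE[p]) ∧
        (μHE[p] S) ^ 2 =
          ∑ I ∈ (Finset.univ : Finset (Fin n)).powersetCard p, (μHE[p] (coordProj e I S)) ^ 2) ∧
    (∀ (e : OrthonormalBasis (Fin n) ℂ (EuclideanSpace ℂ (Fin n)))
        (V : Submodule ℂ (EuclideanSpace ℂ (Fin n))) (S : Set (EuclideanSpace ℂ (Fin n))),
      Module.finrank ℂ V = p → S ⊆ V → NullMeasurableSet S μHE[2 * p] →
        (∀ I ∈ (Finset.univ : Finset (Fin n)).powersetCard p,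
          NullMeasurableSet (coordProj e I S) μHE[2 * p]) ∧
        μHE[2 * p] S =
          ∑ I ∈ (Finset.univ : Finset (Fin n)).powersetCard p, μHE[2 * p] (coordProj e I S)) := by

  constructor
  · rintro e V S rfl hSV hS
    have hT := isometry_subtype_coe.nullMeasurableSet_preimage_euclideanHausdorffMeasure
      (f := (Subtype.val : V → EuclideanSpace ℝ (Fin n))) hS
    refine ⟨fun I _ => ?_, ?_⟩
    · rw [coordProj_eq_image_preimage e I hSV]
      exact LinearMap.nullMeasurableSet_image_euclideanHausdorffMeasure _ hT
    · simp_rw [coordProj_eq_image_preimage e _ hSV, LinearMap.euclideanHausdorffMeasure_image,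
        euclideanHausdorffMeasure_val_preimage hSV, mul_pow,
        ← ENNReal.ofReal_pow (LinearMap.normDet_nonneg _)]
      rw [← Finset.sum_mul, ← ENNReal.ofReal_sum_of_nonneg fun _ _ => sq_nonneg _,
        sum_normDet_starProjection_coordSubspace_sq, ENNReal.ofReal_one, one_mul]
  · rintro e V S rfl hSV hS
    refine ⟨fun I _ => ?_, ?_⟩
    · rw [coordProj_eq_image_preimage e I hSV]
      exact V.nullMeasurableSet_image_preimage_complex (coordProjMap e I V) hS
    · simp_rw [coordProj_eq_image_preimage e _ hSV]
      rw [Finset.sum_congr rfl fun I _ =>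
          V.euclideanHausdorffMeasure_image_preimage_complex (coordProjMap e I V) hSV,
        ← Finset.sum_mul, ← ENNReal.ofReal_sum_of_nonneg fun _ _ => sq_nonneg _,
        sum_normDet_starProjection_coordSubspace_sq, ENNReal.ofReal_one, one_mul]
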